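/- Let $\mathcal F^2$ be the Fock space of all entire functions $f$ on $\mathbb C$ that are square integrable with respect to $d\mu(z)=\pi^{-1}e^{-|z|^2}\,dA(z)$, with inner product $\langle f,g\rangle=\int_{\mathbb C} f\overline g\,d\mu$, and let $K_w(z)=e^{\overline w z}$ for $w\in\mathbb C$. Let $\psi$ be an entire function that is not identically zero, let $a,b\in\mathbb C$ with $|a|<1$, let $\varphi(z)=az+b$, and let $C_{\psi,\varphi}f=\psi\cdot(f\circ\varphi)$. Suppose that, if $C_{\psi,\varphi}$ is a bounded operator on $\mathcal F^2$, then $|\lambda|\le\left|\psi\!\left(\frac{b}{1-a}\right)\right|$ for every $\lambda$ in its essential spectrum $\sigma_e(C_{\psi,\varphi})$ (the spectrum of the class of $C_{\psi,\varphi}$ in the algebra of bounded operators modulo compact operators). Then $C_{\psi,\varphi}$ is a bounded normaloid operator on $\mathcal F^2$ (that is, it is bounded and its norm equals its spectral radius) if and only if $$\psi=\psi(0)\,K_{b\frac{\overline a-1}{a-1}} .$$ -/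

import Mathlib

open MeasureTheory

noncomputable section

namespace Fock

/-- The Gaussian measure `dμ(z) = π⁻¹ e^{-|z|²} dA(z)` on `ℂ`. -/
def gaussian : Measure ℂ :=
  (volume : Measure ℂ).withDensity
    (fun z => ENNReal.ofReal (Real.pi⁻¹ * Real.exp (-‖z‖ ^ 2)))

theorem volume_absolutelyContinuous_gaussian : (volume : Measure ℂ) ≪ gaussian := by
  refine withDensity_absolutelyContinuous' ?_ ?_
  · exact (Measurable.ennreal_ofReal (by fun_prop)).aemeasurable
  · refine Filter.Eventually.of_forall fun z => ?_
    simp only [ne_eq, ENNReal.ofReal_eq_zero, not_le]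
    positivity

instance : gaussian.IsOpenPosMeasure :=
  volume_absolutelyContinuous_gaussian.isOpenPosMeasure

/-- The entire functions that are square integrable with respect to the Gaussian measure,
as a linear subspace of all functions `ℂ → ℂ`. -/
def submodule : Submodule ℂ (ℂ → ℂ) where
  carrier := {f | Differentiable ℂ f ∧ MemLp f 2 gaussian}
  zero_mem' := ⟨differentiable_const 0, MemLp.zero⟩
  add_mem' hf hg := ⟨hf.1.add hg.1, hf.2.add hg.2⟩
  smul_mem' c _ hf := ⟨hf.1.const_smul c, hf.2.const_smul c⟩

/-- The Fock space `𝓕²`. (A type of its own, so that it carries the `L²` norm and not the topology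
of pointwise convergence of a subspace of `ℂ → ℂ`.) -/
def FockSpace : Type := submodule

namespace FockSpace

instance : AddCommGroup FockSpace := inferInstanceAs (AddCommGroup submodule)

instance : Module ℂ FockSpace := inferInstanceAs (Module ℂ submodule)

/-- The entire function that an element of the Fock space is. -/
def toFun (f : FockSpace) : ℂ → ℂ := Subtype.val (p := (· ∈ submodule)) f

instance : CoeFun FockSpace (fun _ => ℂ → ℂ) := ⟨toFun⟩

/-- The element of the Fock space given by an entire square integrable function. -/
def mk (f : ℂ → ℂ) (hf : f ∈ submodule) : FockSpace := (⟨f, hf⟩ : submodule)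

theorem mk_apply (f : ℂ → ℂ) (hf : f ∈ submodule) (z : ℂ) : mk f hf z = f z := rfl

theorem mem_submodule (f : FockSpace) : (f : ℂ → ℂ) ∈ submodule :=
  Subtype.property (p := (· ∈ submodule)) f

theorem differentiable (f : FockSpace) : Differentiable ℂ f := f.mem_submodule.1

theorem memLp (f : FockSpace) : MemLp f 2 gaussian := f.mem_submodule.2

theorem ext {f g : FockSpace} (h : ∀ z, f z = g z) : f = g :=
  Subtype.ext (p := (· ∈ submodule)) (funext h)

theorem add_apply (f g : FockSpace) (z : ℂ) : (f + g) z = f z + g z := rfl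

theorem smul_apply (c : ℂ) (f : FockSpace) (z : ℂ) : (c • f) z = c * f z := rfl

/-- The class in `L²(μ)` of an element of the Fock space. -/
def toL2 (f : FockSpace) : Lp ℂ 2 gaussian := f.memLp.toLp f

theorem inner_toL2 (f g : FockSpace) :
    inner ℂ f.toL2 g.toL2 = ∫ z, inner ℂ (f z) (g z) ∂gaussian := by
  rw [L2.inner_def]
  refine integral_congr_ae ?_
  filter_upwards [f.memLp.coeFn_toLp, g.memLp.coeFn_toLp] with z hf hg
  simp only [toL2, hf, hg]

/-- The inner product `∫ f ḡ dμ` of the Fock space; with Mathlib's convention that inner products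
are conjugate linear in the first variable, it is `inner g f`. -/
@[reducible]
def core : InnerProductSpace.Core ℂ FockSpace where
  inner f g := ∫ z, inner ℂ (f z) (g z) ∂gaussian
  conj_inner_symm f g := by
    rw [← inner_toL2, ← inner_toL2, inner_conj_symm]
  re_inner_nonneg f := by
    rw [← inner_toL2]
    exact inner_self_nonneg
  add_left f g h := by
    rw [← inner_toL2, ← inner_toL2, ← inner_toL2, ← inner_add_left]
    rfl
  smul_left f g c := by
    rw [← inner_toL2, ← inner_toL2, ← inner_smul_left]
    rfl
  definite f hf := by
    rw [← inner_toL2, inner_self_eq_zero] at hf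
    have h : (f : ℂ → ℂ) =ᵐ[gaussian] fun _ => 0 := by
      have h1 := f.memLp.coeFn_toLp
      have h2 : f.memLp.toLp f = 0 := hf
      rw [h2] at h1
      filter_upwards [h1, Lp.coeFn_zero ℂ 2 gaussian] with z h3 h4
      rw [← h3, h4]
      rfl
    have h' := Measure.eq_of_ae_eq h f.differentiable.continuous continuous_const
    exact ext fun z => congrFun h' z

instance : NormedAddCommGroup FockSpace :=
  @InnerProductSpace.Core.toNormedAddCommGroup ℂ FockSpace _ _ _ core

instance : InnerProductSpace ℂ FockSpace :=
  InnerProductSpace.ofCore core.toCore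

theorem inner_eq_integral (f g : FockSpace) :
    inner ℂ f g = ∫ z, inner ℂ (f z) (g z) ∂gaussian := rfl

end FockSpace

/-- The reproducing kernel function `K_w(z) = e^{w̄ z}`. -/
def kernel (w z : ℂ) : ℂ := Complex.exp ((starRingEnd ℂ) w * z)

/-- `C_{ψ,φ} f = ψ · (f ∘ φ)` maps the Fock space into itself and is a bounded operator on it. -/
def IsBoundedWCO (ψ φ : ℂ → ℂ) : Prop :=
  ∃ M : ℝ, ∀ f : FockSpace, ∃ g : FockSpace, (∀ z, g z = ψ z * f (φ z)) ∧ ‖g‖ ≤ M * ‖f‖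

theorem IsBoundedWCO.mem {ψ φ : ℂ → ℂ} (h : IsBoundedWCO ψ φ) (f : FockSpace) :
    (fun z => ψ z * f (φ z)) ∈ submodule := by
  obtain ⟨M, hM⟩ := h
  obtain ⟨g, hg, -⟩ := hM f
  have e : (fun z => ψ z * f (φ z)) = g := funext fun z => (hg z).symm
  rw [e]
  exact g.mem_submodule

/-- The weighted composition operator `C_{ψ,φ} f = ψ · (f ∘ φ)` as a bounded linear operator on the
Fock space, when it is one. -/
def wco (ψ φ : ℂ → ℂ) (h : IsBoundedWCO ψ φ) : FockSpace →L[ℂ] FockSpace :=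
  LinearMap.mkContinuousOfExistsBound
    { toFun := fun f => FockSpace.mk (fun z => ψ z * f (φ z)) (h.mem f)
      map_add' := fun f g => FockSpace.ext fun z => mul_add (ψ z) (f (φ z)) (g (φ z))
      map_smul' := fun c f => FockSpace.ext fun z => mul_left_comm (ψ z) c (f (φ z)) }
    (by
      obtain ⟨M, hM⟩ := h
      refine ⟨M, fun f => ?_⟩
      obtain ⟨g, hg, hgM⟩ := hM f
      have e : g = FockSpace.mk (fun z => ψ z * f (φ z)) (IsBoundedWCO.mem ⟨M, hM⟩ f) :=
        FockSpace.ext hg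
      rw [e] at hgM
      exact hgM)

theorem wco_apply {ψ φ : ℂ → ℂ} (h : IsBoundedWCO ψ φ) (f : FockSpace) (z : ℂ) :
    wco ψ φ h f z = ψ z * f (φ z) := rfl

section Operators

variable {E : Type*} [NormedAddCommGroup E] [NormedSpace ℂ E]

/-- The essential spectrum: the spectrum of the class of `T` in the Calkin algebra (bounded
operators modulo compact operators), that is, the set of all `l` such that `l - T` has no inverse
modulo the compact operators. -/
def essentialSpectrum (T : E →L[ℂ] E) : Set ℂ :=
  {l | ¬ ∃ S : E →L[ℂ] E,
    IsCompactOperator (S * (algebraMap ℂ (E →L[ℂ] E) l - T) - 1 : E →L[ℂ] E) ∧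
    IsCompactOperator ((algebraMap ℂ (E →L[ℂ] E) l - T) * S - 1 : E →L[ℂ] E)}

/-- A bounded operator is normaloid if its spectral radius equals its norm. -/
def IsNormaloid (T : E →L[ℂ] E) : Prop :=
  spectralRadius ℂ T = (‖T‖₊ : ENNReal)

end Operators

end Fock

end

/-! Write `T` for the operator, `p = b / (1 - a)` for the fixed point of the symbol, `K_p` for the
kernel there. If `T` is normaloid, some spectral value `l` has `‖l‖ = ‖T‖`. Were `‖l‖ > ‖ψ p‖`, then
`l` would lie outside the essential spectrum and, having maximal modulus, would be an eigenvalue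
(`exists_eigenvector_of_norm_eq`). But comparing leading Taylor terms of an eigenfunction at `p`
gives `l = ψ p * a ^ n` (`norm_eigenvalue_le`). Hence `‖T‖ ≤ ‖ψ p‖`, and equality in Cauchy–Schwarz
forces `T K_p = ψ p • K_p` (`wco_repro_eq_of_norm_le`). As `K_p` has no zeros, this equation
determines `ψ`. Conversely, for such a kernel weight the adjoint is again a weighted composition
operator and commutes with `T`; a normal operator is normaloid. -/

open MeasureTheory

noncomputable section

namespace Fock

/-! ### Spectral values of maximal modulus outside the essential spectrum -/

section Operators

variable {E : Type*} [NormedAddCommGroup E] [NormedSpace ℂ E]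

/-- An operator with a left inverse modulo compact operators is bounded below if it is injective. -/
theorem exists_bound_below_of_compact_sub_one {A S : E →L[ℂ] E}
    (hK : IsCompactOperator (S * A - 1 : E →L[ℂ] E)) (hinj : ∀ x, A x = 0 → x = 0) :
    ∃ c > 0, ∀ x, c * ‖x‖ ≤ ‖A x‖ := by
  by_contra! hcon
  have hex : ∀ n : ℕ, ∃ x : E, ‖x‖ = 1 ∧ ‖A x‖ < 1 / ((n : ℝ) + 1) := by
    intro n
    obtain ⟨x, hx⟩ := hcon (1 / ((n : ℝ) + 1)) (by positivity)
    have hx0 : x ≠ 0 := by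
      rintro rfl
      simp at hx
    have hpos : 0 < ‖x‖ := norm_pos_iff.2 hx0
    refine ⟨((‖x‖⁻¹ : ℝ) : ℂ) • x, ?_, ?_⟩
    · rw [norm_smul, Complex.norm_real, norm_inv, norm_norm, inv_mul_cancel₀ hpos.ne']
    · rw [map_smul, norm_smul, Complex.norm_real, norm_inv, norm_norm, inv_mul_lt_iff₀ hpos,
        mul_comm]
      exact hx
  choose x hx1 hx2 using hex
  have hA : Filter.Tendsto (fun n => A (x n)) Filter.atTop (nhds 0) :=
    squeeze_zero_norm (fun n => (hx2 n).le) tendsto_one_div_add_atTop_nhds_zero_nat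
  -- Along a subsequence `S A x - x` converges to `y` while `S A x → 0`, so the unit vectors `x`
  -- converge to `-y`, which lies in the kernel of `A`.
  obtain ⟨y, -, φ, hφ, hy⟩ := (hK.isCompact_closure_image_closedBall 1).tendsto_subseq
    (x := fun n => (S * A - 1 : E →L[ℂ] E) (x n))
    (fun n => subset_closure ⟨x n, by simp [hx1 n], rfl⟩)
  have hAφ := hA.comp hφ.tendsto_atTop
  have hlim : Filter.Tendsto (fun n => x (φ n)) Filter.atTop (nhds (-y)) := by
    have h1 : Filter.Tendsto (fun n => S (A (x (φ n)))) Filter.atTop (nhds 0) := by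
      have := (S.continuous.tendsto 0).comp hAφ
      simpa [Function.comp_def] using this
    have h2 := h1.sub hy
    simpa [Function.comp_def] using h2
  have hnorm : ‖-y‖ = 1 := by
    refine tendsto_nhds_unique hlim.norm ?_
    simp [hx1]
  have hzero : A (-y) = 0 :=
    tendsto_nhds_unique ((A.continuous.tendsto _).comp hlim) hAφ
  rw [hinj _ hzero, norm_zero] at hnorm
  exact zero_ne_one hnorm

/-- A point of the spectrum of modulus `‖T‖` that lies outside the essential spectrum is an
eigenvalue. -/
theorem exists_eigenvector_of_norm_eq [CompleteSpace E] (T : E →L[ℂ] E)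
    {l : ℂ} (hl : l ∈ spectrum ℂ T) (hl0 : l ≠ 0) (hnorm : ‖l‖ = ‖T‖)
    (hess : l ∉ essentialSpectrum T) : ∃ x : E, x ≠ 0 ∧ T x = l • x := by
  by_contra! hcon
  simp only [essentialSpectrum, Set.mem_ofPred_eq, not_not] at hess
  obtain ⟨S, hS, -⟩ := hess
  obtain ⟨c, hc, hbound⟩ := exists_bound_below_of_compact_sub_one hS (by
    intro x hx
    by_contra hx0
    refine hcon x hx0 ?_
    rw [sub_apply, sub_eq_zero] at hx
    rw [← hx, Algebra.algebraMap_eq_smul_one]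
    rfl)
  set A : E →L[ℂ] E := algebraMap ℂ (E →L[ℂ] E) l - T with hA
  have hlpos : 0 < ‖l‖ := norm_pos_iff.2 hl0
  -- Push `l` radially out of the disc of radius `‖T‖` by `c / 3`. The lower bound `c` for `l - T`
  -- leaves `2c / 3` for `m - T`, so the resolvent at `m` has norm at most `3 / (2c)`, and a Neumann
  -- series of ratio `1 / 2` inverts `l - T`.
  set t : ℝ := c / (3 * ‖l‖) with ht
  have htpos : 0 < t := by positivity
  set m : ℂ := l + (t : ℂ) * l with hm
  have hml : ‖m - l‖ = c / 3 := by
    rw [hm, add_sub_cancel_left, norm_mul, Complex.norm_real, Real.norm_of_nonneg htpos.le, ht]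
    field_simp
  have hmT : ‖T‖ < ‖m‖ := by
    have : m = ((1 + t : ℝ) : ℂ) * l := by rw [hm]; push_cast; ring
    rw [this, norm_mul, Complex.norm_real, Real.norm_of_nonneg (by positivity), ← hnorm]
    nlinarith
  have hunit : IsUnit (algebraMap ℂ (E →L[ℂ] E) m - T) := by
    have hnt : Nontrivial E := by
      by_contra h
      rw [not_nontrivial_iff_subsingleton] at h
      have : T = 0 := Subsingleton.elim _ _
      rw [this, norm_zero] at hnorm
      exact hlpos.ne' hnorm
    exact spectrum.mem_resolventSet_of_norm_lt hmT
  obtain ⟨B, hB⟩ := hunit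
  have hAB : A = B * (1 - (m - l) • (↑B⁻¹ : E →L[ℂ] E)) := by
    rw [mul_sub, mul_one, mul_smul_comm, Units.mul_inv, hB, hA, sub_smul,
      Algebra.algebraMap_eq_smul_one, Algebra.algebraMap_eq_smul_one]
    abel
  have hBinv : ‖(↑B⁻¹ : E →L[ℂ] E)‖ ≤ 3 / (2 * c) := by
    refine ContinuousLinearMap.opNorm_le_bound _ (by positivity) fun x => ?_
    set y := (↑B⁻¹ : E →L[ℂ] E) x with hy
    have hx : (B : E →L[ℂ] E) y = x := by
      rw [hy, ← mul_apply_eq_comp, Units.mul_inv]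
      rfl
    have hAy : A y = x - (m - l) • y := by
      rw [← hx, hB, hA]
      simp only [sub_apply, Algebra.algebraMap_eq_smul_one,
        smul_apply, one_apply_eq_self, sub_smul]
      abel
    have h1 := hbound y
    have h2 : ‖A y‖ ≤ ‖x‖ + c / 3 * ‖y‖ := by
      rw [hAy]
      refine (norm_sub_le _ _).trans ?_
      rw [norm_smul, hml]
    rw [div_mul_eq_mul_div, le_div_iff₀ (by positivity)]
    nlinarith
  refine spectrum.mem_iff.1 hl ?_
  change IsUnit A
  rw [hAB]
  refine B.isUnit.mul (isUnit_one_sub_of_norm_lt_one ?_)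
  calc ‖(m - l) • (↑B⁻¹ : E →L[ℂ] E)‖ ≤ c / 3 * (3 / (2 * c)) := by
        rw [norm_smul, hml]
        gcongr
    _ = 1 / 2 := by field_simp
    _ < 1 := by norm_num

end Operators

/-! ### Gaussian integrals and the mean value property -/

theorem integrable_exp_neg_mul_sq {c : ℝ} (hc : 0 < c) :
    Integrable (fun z : ℂ => Real.exp (-c * ‖z‖ ^ 2)) := by
  have h := (GaussianFourier.integrable_cexp_neg_mul_sq_norm_add (V := ℂ) (b := (c : ℂ))
    (by simpa using hc) 0 0).norm
  refine h.congr (Filter.Eventually.of_forall fun z => ?_)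
  simp only [Complex.norm_exp, zero_mul, add_zero]
  congr 1
  norm_cast

theorem measurable_density :
    Measurable fun z : ℂ => ENNReal.ofReal (Real.pi⁻¹ * Real.exp (-‖z‖ ^ 2)) :=
  Measurable.ennreal_ofReal (by fun_prop)

theorem toReal_density (z : ℂ) :
    (ENNReal.ofReal (Real.pi⁻¹ * Real.exp (-‖z‖ ^ 2))).toReal
      = Real.pi⁻¹ * Real.exp (-‖z‖ ^ 2) :=
  ENNReal.toReal_ofReal (by positivity)

theorem integrable_gaussian_iff {f : ℂ → ℂ} :
    Integrable f gaussian ↔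
      Integrable fun z => (Real.pi⁻¹ * Real.exp (-‖z‖ ^ 2)) • f z := by
  rw [gaussian, integrable_withDensity_iff_integrable_smul' measurable_density
    (Filter.Eventually.of_forall fun z => ENNReal.ofReal_lt_top)]
  simp only [toReal_density]

theorem integral_gaussian (f : ℂ → ℂ) :
    ∫ z, f z ∂gaussian = ∫ z, (Real.pi⁻¹ * Real.exp (-‖z‖ ^ 2)) • f z := by
  rw [gaussian, integral_withDensity_eq_integral_toReal_smul measurable_density
    (Filter.Eventually.of_forall fun z => ENNReal.ofReal_lt_top)]
  simp only [toReal_density]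

instance : IsProbabilityMeasure gaussian := by
  constructor
  rw [gaussian, withDensity_apply _ MeasurableSet.univ, Measure.restrict_univ,
    ← ofReal_integral_eq_lintegral_ofReal]
  · rw [integral_const_mul]
    have h := GaussianFourier.integral_rexp_neg_mul_sq_norm (V := ℂ) one_pos
    simp only [neg_mul, one_mul, Complex.finrank_real_complex] at h
    rw [h]
    simp [Real.pi_ne_zero]
  · simpa using (integrable_exp_neg_mul_sq one_pos).const_mul Real.pi⁻¹
  · exact Filter.Eventually.of_forall fun z => by positivity

/-- The Gaussian integrates exponentials of order less than `‖z‖²`. -/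
theorem integrable_exp_quadratic {c : ℝ} (hc : c < 1) (d : ℝ) :
    Integrable (fun z : ℂ => Real.exp (c * ‖z‖ ^ 2 + d * ‖z‖)) gaussian := by
  rw [gaussian, integrable_withDensity_iff measurable_density
    (Filter.Eventually.of_forall fun z => ENNReal.ofReal_lt_top)]
  simp only [toReal_density]
  have hc' : 0 < 1 - c := sub_pos.2 hc
  refine Integrable.mono'
    ((integrable_exp_neg_mul_sq (half_pos hc')).const_mul
      (Real.pi⁻¹ * Real.exp (d ^ 2 / (2 * (1 - c)))))
    (by fun_prop) (Filter.Eventually.of_forall fun z => ?_)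
  rw [Real.norm_of_nonneg (by positivity)]
  -- Completing the square: half of the decay rate `1 - c` absorbs the linear term.
  have h : c * ‖z‖ ^ 2 + d * ‖z‖ + -‖z‖ ^ 2
      ≤ d ^ 2 / (2 * (1 - c)) + -((1 - c) / 2) * ‖z‖ ^ 2 := by
    have h1 : 0 ≤ ((1 - c) * ‖z‖ - d) ^ 2 / (2 * (1 - c)) := by positivity
    have h2 : ((1 - c) * ‖z‖ - d) ^ 2 / (2 * (1 - c))
        = (1 - c) / 2 * ‖z‖ ^ 2 - d * ‖z‖ + d ^ 2 / (2 * (1 - c)) := by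
      field_simp
      ring
    rw [h2] at h1
    linarith
  calc Real.exp (c * ‖z‖ ^ 2 + d * ‖z‖) * (Real.pi⁻¹ * Real.exp (-‖z‖ ^ 2))
      = Real.pi⁻¹ * Real.exp (c * ‖z‖ ^ 2 + d * ‖z‖ + -‖z‖ ^ 2) := by
        rw [Real.exp_add (c * ‖z‖ ^ 2 + d * ‖z‖)]
        ring
    _ ≤ Real.pi⁻¹ *
        Real.exp (d ^ 2 / (2 * (1 - c)) + -((1 - c) / 2) * ‖z‖ ^ 2) := by
        gcongr
    _ = _ := by rw [Real.exp_add]; ring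

theorem measurePreserving_rotation (u : Circle) :
    MeasurePreserving (fun z : ℂ => (u : ℂ) * z) gaussian gaussian := by
  have hv : MeasurePreserving (fun z : ℂ => (u : ℂ) * z) volume volume :=
    (rotation u).measurePreserving
  refine ⟨hv.measurable, ?_⟩
  ext s hs
  rw [Measure.map_apply hv.measurable hs, gaussian, withDensity_apply _ hs,
    withDensity_apply _ (hv.measurable hs),
    ← hv.setLIntegral_comp_preimage hs measurable_density]
  simp [Circle.norm_coe u]

theorem integral_circle_mul {f : ℂ → ℂ} (hf : Differentiable ℂ f) (z : ℂ) :
    ∫ θ in (0 : ℝ)..2 * Real.pi, f (circleMap 0 1 θ * z) = 2 * Real.pi * f 0 := by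
  have hg : Differentiable ℂ fun w => f (w * z) := hf.comp (differentiable_id.mul_const z)
  have h := (hg.diffContOnCl (s := Metric.ball 0 |1|)).circleAverage
  rw [Real.circleAverage, zero_mul] at h
  rw [← h, Complex.real_smul]
  push_cast
  rw [← mul_assoc, mul_inv_cancel₀ (by simp [Real.pi_ne_zero]), one_mul]

/-- The mean value property with respect to the Gaussian measure. -/
theorem integral_gaussian_eq {f : ℂ → ℂ} (hf : Differentiable ℂ f)
    (hint : Integrable f gaussian) : ∫ z, f z ∂gaussian = f 0 := by
  have hrot (θ : ℝ) : MeasurePreserving (fun z : ℂ => circleMap 0 1 θ * z) gaussian gaussian := by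
    have := measurePreserving_rotation (Circle.exp θ)
    simpa [circleMap] using this
  have hemb (θ : ℝ) : MeasurableEmbedding (fun z : ℂ => circleMap 0 1 θ * z) :=
    (Homeomorph.mulLeft₀ (circleMap 0 1 θ) (by simp [circleMap])).measurableEmbedding
  have hcont : Continuous (Function.uncurry fun (θ : ℝ) (z : ℂ) => f (circleMap 0 1 θ * z)) := by
    have := hf.continuous
    have := continuous_circleMap 0 1
    simp only [Function.uncurry_def]
    fun_prop
  -- Integrate `f (e^{iθ} z)` in both orders: rotation invariance gives `2π ∫ f`, the mean value
  -- property on circles gives `2π f 0`.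
  have hswap := integral_integral_swap (μ := volume.restrict (Set.Ioc 0 (2 * Real.pi)))
    (ν := gaussian) (f := fun (θ : ℝ) (z : ℂ) => f (circleMap 0 1 θ * z)) (by
      rw [integrable_prod_iff hcont.aestronglyMeasurable]
      refine ⟨Filter.Eventually.of_forall fun θ =>
        ((hrot θ).integrable_comp_emb (hemb θ)).2 hint, ?_⟩
      have : (fun θ : ℝ => ∫ z, ‖Function.uncurry (fun (θ : ℝ) (z : ℂ) =>
          f (circleMap 0 1 θ * z)) (θ, z)‖ ∂gaussian) = fun _ => ∫ z, ‖f z‖ ∂gaussian :=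
        funext fun θ => (hrot θ).integral_comp (hemb θ) fun z => ‖f z‖
      rw [this]
      exact integrable_const _)
  have hl (θ : ℝ) : ∫ z, f (circleMap 0 1 θ * z) ∂gaussian = ∫ z, f z ∂gaussian :=
    (hrot θ).integral_comp (hemb θ) f
  simp only [hl, ← intervalIntegral.integral_of_le Real.two_pi_pos.le,
    integral_circle_mul hf] at hswap
  have h2 : (2 * Real.pi : ℂ) ≠ 0 := by simp [Real.pi_ne_zero]
  refine mul_left_cancel₀ h2 ?_
  simpa using hswap

/-! ### Reproducing kernels and completeness -/

theorem differentiable_kernel (w : ℂ) : Differentiable ℂ (kernel w) := by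
  unfold kernel
  fun_prop

theorem norm_kernel_le (w z : ℂ) : ‖kernel w z‖ ≤ Real.exp (‖w‖ * ‖z‖) := by
  rw [kernel, Complex.norm_exp]
  gcongr
  refine (Complex.re_le_norm _).trans ?_
  simp

/-- Entire functions of Gaussian growth of type less than `1/2` belong to the Fock space. -/
theorem mem_submodule_of_norm_le {f : ℂ → ℂ} (hf : Differentiable ℂ f) {M c d : ℝ} (hc : c < 1)
    (h : ∀ z, ‖f z‖ ^ 2 ≤ M * Real.exp (c * ‖z‖ ^ 2 + d * ‖z‖)) : f ∈ submodule := by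
  refine ⟨hf, (memLp_two_iff_integrable_sq_norm hf.continuous.aestronglyMeasurable).2 ?_⟩
  refine Integrable.mono' ((integrable_exp_quadratic hc d).const_mul M)
    (hf.continuous.norm.pow 2).aestronglyMeasurable (Filter.Eventually.of_forall fun z => ?_)
  rw [Real.norm_of_nonneg (by positivity)]
  exact h z

namespace FockSpace

theorem norm_sq_eq (f : FockSpace) : ‖f‖ ^ 2 = ∫ z, ‖f z‖ ^ 2 ∂gaussian := by
  have h : inner ℂ f f = ((∫ z, ‖f z‖ ^ 2 ∂gaussian : ℝ) : ℂ) := by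
    rw [inner_eq_integral, ← integral_complex_ofReal]
    refine integral_congr_ae (Filter.Eventually.of_forall fun z => ?_)
    simp only [inner_self_eq_norm_sq_to_K]
    simp
  have h2 : inner ℂ f f = ((‖f‖ : ℝ) : ℂ) ^ 2 := inner_self_eq_norm_sq_to_K f
  rw [h2] at h
  exact_mod_cast h

/-- The reproducing kernel as an element of the Fock space. -/
def repro (w : ℂ) : FockSpace :=
  mk (kernel w) (mem_submodule_of_norm_le (differentiable_kernel w) (M := 1) (c := 0)
    (d := 2 * ‖w‖) one_pos fun z => by
      refine (pow_le_pow_left₀ (norm_nonneg _) (norm_kernel_le w z) 2).trans_eq ?_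
      rw [← Real.exp_nat_mul, one_mul, zero_mul, zero_add]
      push_cast
      ring_nf)

theorem repro_apply (w z : ℂ) : repro w z = kernel w z := rfl

theorem integrable_inner (f g : FockSpace) :
    Integrable (fun z => inner ℂ (f z) (g z)) gaussian :=
  (L2.integrable_inner f.toL2 g.toL2).congr <| by
    filter_upwards [f.memLp.coeFn_toLp, g.memLp.coeFn_toLp] with z hf hg
    simp only [toL2, hf, hg]

/-- Translating by `w` cancels the kernel's `conj z` dependence against the cross term of `‖z + w‖ ^
2`. What remains is the Gaussian mean of an entire function `F` with `F 0 = f w`. -/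
theorem inner_repro (w : ℂ) (f : FockSpace) : inner ℂ (repro w) f = f w := by
  set F : ℂ → ℂ := fun z => f (z + w) * Complex.exp (-(starRingEnd ℂ) w * z) with hF
  have hFd : Differentiable ℂ F :=
    (f.differentiable.comp (differentiable_id.add_const w)).mul (by fun_prop)
  set G : ℂ → ℂ := fun z => (Real.pi⁻¹ * Real.exp (-‖z‖ ^ 2)) • inner ℂ (repro w z) (f z) with hG
  have hGF (z : ℂ) : G (z + w) = (Real.pi⁻¹ * Real.exp (-‖z‖ ^ 2)) • F z := by
    simp only [hG, hF, repro_apply, kernel, RCLike.inner_apply, Complex.real_smul,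
      ← Complex.exp_conj]
    push_cast
    simp only [← Complex.conj_mul', map_add, map_mul, Complex.conj_conj]
    have h : Complex.exp (-(((starRingEnd ℂ) z + (starRingEnd ℂ) w) * (z + w)))
        * Complex.exp (w * ((starRingEnd ℂ) z + (starRingEnd ℂ) w))
        = Complex.exp (-((starRingEnd ℂ) z * z)) * Complex.exp (-(starRingEnd ℂ) w * z) := by
      rw [← Complex.exp_add, ← Complex.exp_add]
      congr 1
      ring
    linear_combination (Real.pi : ℂ)⁻¹ * f (z + w) * h
  have hGint : Integrable G := integrable_gaussian_iff.1 (integrable_inner (repro w) f)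
  have hFint : Integrable F gaussian := by
    rw [integrable_gaussian_iff]
    simpa only [hGF] using hGint.comp_add_right w
  rw [inner_eq_integral, integral_gaussian]
  change ∫ z, G z = _
  rw [← integral_add_right_eq_self G w]
  simp only [hGF]
  rw [← integral_gaussian, integral_gaussian_eq hFd hFint]
  simp [hF]

theorem norm_repro_sq (w : ℂ) : ‖repro w‖ ^ 2 = Real.exp (‖w‖ ^ 2) := by
  have h : inner ℂ (repro w) (repro w) = ((‖repro w‖ : ℝ) : ℂ) ^ 2 :=
    inner_self_eq_norm_sq_to_K _
  rw [inner_repro, repro_apply, kernel, Complex.conj_mul'] at h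
  exact_mod_cast h.symm

theorem norm_apply_sq_le (f : FockSpace) (z : ℂ) :
    ‖f z‖ ^ 2 ≤ Real.exp (‖z‖ ^ 2) * ‖f‖ ^ 2 := by
  rw [← inner_repro, ← norm_repro_sq, ← mul_pow]
  exact pow_le_pow_left₀ (norm_nonneg _) (norm_inner_le_norm _ _) 2

theorem norm_apply_le (f : FockSpace) (z : ℂ) : ‖f z‖ ≤ ‖repro z‖ * ‖f‖ := by
  rw [← inner_repro]
  exact norm_inner_le_norm _ _

theorem sub_apply (f g : FockSpace) (z : ℂ) : (f - g) z = f z - g z := rfl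

theorem norm_toL2 (f : FockSpace) : ‖f.toL2‖ = ‖f‖ := by
  rw [@norm_eq_sqrt_re_inner ℂ, @norm_eq_sqrt_re_inner ℂ _ _ _ _ f, inner_toL2, inner_eq_integral]

theorem toL2_sub (f g : FockSpace) : (f - g).toL2 = f.toL2 - g.toL2 := rfl

/-- Point evaluations are bounded uniformly on compact sets, so a Cauchy sequence converges locally
uniformly to an entire function; an a.e. convergent subsequence identifies it with the `L²` limit.
-/
instance : CompleteSpace FockSpace := by
  refine Metric.complete_of_cauchySeq_tendsto fun u hu => ?_
  have hL2 : CauchySeq fun n => (u n).toL2 := by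
    rw [Metric.cauchySeq_iff] at hu ⊢
    simpa only [dist_eq_norm, ← toL2_sub, norm_toL2] using hu
  obtain ⟨g, hg⟩ := cauchySeq_tendsto_of_complete hL2
  have hunif : ∀ K : Set ℂ, IsCompact K → UniformCauchySeqOn (fun n z => u n z) Filter.atTop K := by
    intro K hK
    obtain ⟨R, hR⟩ := hK.isBounded.exists_norm_le
    rw [Metric.uniformCauchySeqOn_iff]
    intro ε hε
    set C : ℝ := Real.exp (R ^ 2) with hC
    have hCpos : 0 < C := Real.exp_pos _
    obtain ⟨N, hN⟩ := Metric.cauchySeq_iff.1 hu (ε / C) (by positivity)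
    refine ⟨N, fun m hm n hn z hz => ?_⟩
    have hz' : ‖repro z‖ ≤ C := by
      have h1 : ‖repro z‖ ^ 2 ≤ C ^ 2 := by
        rw [norm_repro_sq, hC, ← Real.exp_nat_mul]
        gcongr
        have := pow_le_pow_left₀ (norm_nonneg z) (hR z hz) 2
        push_cast
        nlinarith [sq_nonneg R]
      exact le_of_sq_le_sq h1 hCpos.le
    have h2 := hN m hm n hn
    rw [dist_eq_norm, lt_div_iff₀ hCpos] at h2
    rw [dist_eq_norm, ← sub_apply]
    calc ‖(u m - u n) z‖ ≤ ‖repro z‖ * ‖u m - u n‖ := norm_apply_le _ _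
      _ ≤ C * ‖u m - u n‖ := by gcongr
      _ < ε := by linarith
  have hpt (z : ℂ) : ∃ y, Filter.Tendsto (fun n => u n z) Filter.atTop (nhds y) :=
    cauchySeq_tendsto_of_complete
      ((hunif {z} isCompact_singleton).cauchySeq (Set.mem_singleton z))
  choose F hF using hpt
  have hloc : TendstoLocallyUniformlyOn (fun n z => u n z) F Filter.atTop Set.univ := by
    rw [tendstoLocallyUniformlyOn_iff_forall_isCompact isOpen_univ]
    exact fun K _ hK => (hunif K hK).tendstoUniformlyOn_of_tendsto fun z _ => hF z
  have hFd : Differentiable ℂ F := differentiableOn_univ.1 <|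
    hloc.differentiableOn
      (Filter.Eventually.of_forall fun n => (u n).differentiable.differentiableOn) isOpen_univ
  have hFg : F =ᵐ[gaussian] g := by
    obtain ⟨ns, hns, hlim⟩ := (tendstoInMeasure_of_tendsto_Lp hg).exists_seq_tendsto_ae
    have hall : ∀ᵐ z ∂gaussian, ∀ n, (u n).toL2 z = u n z :=
      ae_all_iff.2 fun n => (u n).memLp.coeFn_toLp
    filter_upwards [hlim, hall] with z h1 h2
    simp only [h2] at h1
    exact tendsto_nhds_unique ((hF z).comp hns.tendsto_atTop) h1
  have hFmem : MemLp F 2 gaussian := (memLp_congr_ae hFg).2 (Lp.memLp g)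
  refine ⟨mk F ⟨hFd, hFmem⟩, ?_⟩
  have hgF : (mk F ⟨hFd, hFmem⟩).toL2 = g := by
    refine Lp.ext ?_
    exact hFmem.coeFn_toLp.trans hFg
  rw [tendsto_iff_norm_sub_tendsto_zero] at hg ⊢
  simpa only [← hgF, ← toL2_sub, norm_toL2] using hg

instance : Nontrivial FockSpace := by
  refine ⟨repro 0, 0, fun h => ?_⟩
  have h1 := norm_repro_sq 0
  rw [h] at h1
  simp at h1

end FockSpace

/-! ### Weighted composition operators with kernel weights -/

open FockSpace

/-- A weight of exponential type and an affine symbol of slope less than one in modulus give a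
bounded weighted composition operator. -/
theorem isBoundedWCO_of_kernel {a : ℂ} (ha : ‖a‖ < 1) (s b c : ℂ) :
    IsBoundedWCO (fun z => s * kernel c z) (fun z => a * z + b) := by
  set d : ℝ := 2 * ‖c‖ + 2 * ‖b‖ with hd
  set C : ℝ := ‖s‖ ^ 2 * Real.exp (‖b‖ ^ 2) with hC
  have ha2 : ‖a‖ ^ 2 < 1 := pow_lt_one₀ (norm_nonneg a) ha two_ne_zero
  -- Composition scales the quadratic growth rate by `‖a‖ ^ 2 < 1`; the shift and the weight add
  -- only linear terms to the exponent.
  have hpt (f : FockSpace) (z : ℂ) : ‖s * kernel c z * f (a * z + b)‖ ^ 2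
      ≤ C * ‖f‖ ^ 2 * Real.exp (‖a‖ ^ 2 * ‖z‖ ^ 2 + d * ‖z‖) := by
    have h1 : ‖a * z + b‖ ^ 2 ≤ ‖b‖ ^ 2 + (‖a‖ ^ 2 * ‖z‖ ^ 2 + 2 * ‖b‖ * ‖z‖) := by
      have h2 : ‖a * z + b‖ ≤ ‖a‖ * ‖z‖ + ‖b‖ := (norm_add_le _ _).trans (by rw [norm_mul])
      have h3 := pow_le_pow_left₀ (norm_nonneg _) h2 2
      have h4 : ‖a‖ * (‖b‖ * ‖z‖) ≤ 1 * (‖b‖ * ‖z‖) := by gcongr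
      nlinarith
    calc ‖s * kernel c z * f (a * z + b)‖ ^ 2
        = ‖s‖ ^ 2 * ‖kernel c z‖ ^ 2 * ‖f (a * z + b)‖ ^ 2 := by
          rw [norm_mul, norm_mul, mul_pow, mul_pow]
      _ ≤ ‖s‖ ^ 2 * Real.exp (‖c‖ * ‖z‖) ^ 2 * (Real.exp (‖a * z + b‖ ^ 2) * ‖f‖ ^ 2) := by
          gcongr
          · exact norm_kernel_le c z
          · exact norm_apply_sq_le f _
      _ ≤ ‖s‖ ^ 2 * Real.exp (‖c‖ * ‖z‖) ^ 2 *
          (Real.exp (‖b‖ ^ 2 + (‖a‖ ^ 2 * ‖z‖ ^ 2 + 2 * ‖b‖ * ‖z‖)) * ‖f‖ ^ 2) := by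
          gcongr
      _ = _ := by
          have h5 : d * ‖z‖ = (‖c‖ * ‖z‖ + ‖c‖ * ‖z‖) + 2 * ‖b‖ * ‖z‖ := by rw [hd]; ring
          rw [hC, h5]
          simp only [Real.exp_add]
          ring
  have hdiff (f : FockSpace) : Differentiable ℂ fun z => s * kernel c z * f (a * z + b) :=
    ((differentiable_kernel c).const_mul s).mul (f.differentiable.comp (by fun_prop))
  have hmem (f : FockSpace) : (fun z => s * kernel c z * f (a * z + b)) ∈ submodule :=
    mem_submodule_of_norm_le (hdiff f) ha2 (hpt f)
  set I : ℝ := ∫ z, Real.exp (‖a‖ ^ 2 * ‖z‖ ^ 2 + d * ‖z‖) ∂gaussian with hI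
  refine ⟨Real.sqrt (C * I), fun f => ⟨FockSpace.mk _ (hmem f), fun z => rfl, ?_⟩⟩
  have hI0 : 0 ≤ I := integral_nonneg fun z => (Real.exp_pos _).le
  refine le_of_sq_le_sq ?_ (by positivity)
  rw [mul_pow, Real.sq_sqrt (by positivity), norm_sq_eq]
  calc ∫ z, ‖FockSpace.mk _ (hmem f) z‖ ^ 2 ∂gaussian
      ≤ ∫ z, C * ‖f‖ ^ 2 * Real.exp (‖a‖ ^ 2 * ‖z‖ ^ 2 + d * ‖z‖) ∂gaussian := by
        refine integral_mono ?_ ((integrable_exp_quadratic ha2 d).const_mul _) (hpt f)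
        exact (memLp_two_iff_integrable_sq_norm
          (hdiff f).continuous.aestronglyMeasurable).1 (hmem f).2
    _ = C * I * ‖f‖ ^ 2 := by
        rw [integral_const_mul]
        ring

theorem conj_kernel (w z : ℂ) : (starRingEnd ℂ) (kernel w z) = kernel z w := by
  simp only [kernel, ← Complex.exp_conj, map_mul, Complex.conj_conj]
  rw [mul_comm]

/-- The operator sends `K_w` to a multiple of the kernel at `conj a * w + c`; pairing with `g`
evaluates the adjoint. Taking adjoints thus conjugates `a` and `s` and swaps `b` with `c`. -/
theorem adjoint_wco_kernel_apply {a s b c : ℂ}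
    (h : IsBoundedWCO (fun z => s * kernel c z) (fun z => a * z + b)) (g : FockSpace) (w : ℂ) :
    (wco _ _ h).adjoint g w
      = (starRingEnd ℂ) s * kernel b w * g ((starRingEnd ℂ) a * w + c) := by
  have hk : wco _ _ h (repro w)
      = (s * kernel w b) • repro ((starRingEnd ℂ) a * w + c) := by
    refine FockSpace.ext fun z => ?_
    rw [wco_apply, FockSpace.smul_apply, repro_apply, repro_apply, mul_assoc, mul_assoc]
    congr 1
    simp only [kernel, ← Complex.exp_add, map_add, map_mul, Complex.conj_conj]
    ring_nf
  rw [← inner_repro, ContinuousLinearMap.adjoint_inner_right, hk, inner_smul_left, inner_repro,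
    map_mul, conj_kernel]

/-- `hc` says that the symbols of the operator and its adjoint commute; its conjugate together with
`hbc` matches the weights. -/
theorem isStarNormal_wco_kernel {a s b c : ℂ}
    (h : IsBoundedWCO (fun z => s * kernel c z) (fun z => a * z + b))
    (hc : c * (1 - a) = b * (1 - (starRingEnd ℂ) a))
    (hbc : (starRingEnd ℂ) b * b = (starRingEnd ℂ) c * c) :
    IsStarNormal (wco _ _ h) := by
  have hc' := congrArg (starRingEnd ℂ) hc
  simp only [map_mul, map_sub, map_one, Complex.conj_conj] at hc'
  refine ⟨?_⟩
  rw [Commute, SemiconjBy, ContinuousLinearMap.star_eq_adjoint]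
  refine ContinuousLinearMap.ext fun g => FockSpace.ext fun z => ?_
  rw [mul_apply_eq_comp, mul_apply_eq_comp, adjoint_wco_kernel_apply, wco_apply, wco_apply,
    adjoint_wco_kernel_apply]
  have h1 : a * ((starRingEnd ℂ) a * z + c) + b = (starRingEnd ℂ) a * (a * z + b) + c := by
    linear_combination -hc
  have h2 : kernel b z * kernel c ((starRingEnd ℂ) a * z + c)
      = kernel c z * kernel b (a * z + b) := by
    simp only [kernel, ← Complex.exp_add]
    congr 1
    linear_combination -z * hc' - hbc
  rw [h1]
  linear_combination (starRingEnd ℂ) s * s * g ((starRingEnd ℂ) a * (a * z + b) + c) * h2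

/-! ### Eigenvalues and kernels at the fixed point -/

/-- At the fixed point of the symbol, a nonzero eigenvalue is dominated by the weight. -/
theorem norm_eigenvalue_le {ψ f : ℂ → ℂ} (hψ : Differentiable ℂ ψ) (hf : Differentiable ℂ f)
    (hf0 : f ≠ 0) {a b p l : ℂ} (ha : ‖a‖ ≤ 1) (hp : a * p + b = p)
    (heig : ∀ z, ψ z * f (a * z + b) = l * f z) : ‖l‖ ≤ ‖ψ p‖ := by
  have hne : ¬∀ᶠ z in nhds p, f z = 0 := fun h => hf0 <|
    (Complex.analyticOnNhd_univ_iff_differentiable.2 hf).eq_of_eventuallyEq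
      (g := 0) (fun z _ => analyticAt_const) h
  -- Factor `f = (z - p) ^ n * g` with `g p ≠ 0`. The symbol multiplies `z - p` by `a`, so
  -- cancelling the power off `p` and letting `z → p` gives `l = ψ p * a ^ n`.
  obtain ⟨n, g, hg, hg0, hfg⟩ :=
    (hf.analyticAt p).exists_eventuallyEq_pow_smul_nonzero_iff.2 hne
  have hφ : Filter.Tendsto (fun z => a * z + b) (nhds p) (nhds p) := by
    have : Continuous fun z : ℂ => a * z + b := by fun_prop
    simpa only [hp] using this.tendsto p
  have heq : ∀ᶠ z in nhdsWithin p {p}ᶜ, ψ z * a ^ n * g (a * z + b) = l * g z := by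
    filter_upwards [nhdsWithin_le_nhds hfg, nhdsWithin_le_nhds (hφ.eventually hfg),
      self_mem_nhdsWithin] with z h1 h2 hz
    have hz' : (z - p) ^ n ≠ 0 := pow_ne_zero _ (sub_ne_zero.2 hz)
    have h3 := heig z
    have h4 : a * z + b - p = a * (z - p) := by linear_combination hp
    rw [h1, h2, h4, smul_eq_mul, smul_eq_mul, mul_pow] at h3
    refine mul_left_cancel₀ hz' ?_
    linear_combination h3
  have hgc := hg.continuousAt
  have hlim1 : Filter.Tendsto (fun z => ψ z * a ^ n * g (a * z + b)) (nhdsWithin p {p}ᶜ)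
      (nhds (ψ p * a ^ n * g p)) :=
    (((hψ.continuous.tendsto p).mul_const _).mul (hgc.tendsto.comp hφ)).mono_left
      nhdsWithin_le_nhds
  have hlim2 : Filter.Tendsto (fun z => l * g z) (nhdsWithin p {p}ᶜ) (nhds (l * g p)) :=
    (hgc.tendsto.const_mul l).mono_left nhdsWithin_le_nhds
  have hl := mul_right_cancel₀ hg0
    (tendsto_nhds_unique (hlim1.congr' heq) hlim2)
  rw [← hl, norm_mul, norm_pow]
  exact mul_le_of_le_one_right (norm_nonneg _) (pow_le_one₀ (norm_nonneg _) ha)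

/-- If the weight attains the norm of the operator at a fixed point of the symbol, then the
reproducing kernel there is an eigenvector. -/
theorem wco_repro_eq_of_norm_le {ψ φ : ℂ → ℂ} (h : IsBoundedWCO ψ φ) {p : ℂ} (hp : φ p = p)
    (hnorm : ‖wco ψ φ h‖ ≤ ‖ψ p‖) : wco ψ φ h (repro p) = ψ p • repro p := by
  -- Expand the squared norm of the difference: by reproduction at the fixed point the cross term is
  -- exactly `‖ψ p‖ ^ 2 * ‖K_p‖ ^ 2`, so the total is at most zero.
  rw [← sub_eq_zero, ← norm_eq_zero, ← sq_eq_zero_iff]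
  refine le_antisymm ?_ (sq_nonneg _)
  have h1 : ‖wco ψ φ h (repro p)‖ ≤ ‖ψ p‖ * ‖repro p‖ :=
    (ContinuousLinearMap.le_opNorm _ _).trans (by gcongr)
  have h2 : inner ℂ (ψ p • repro p) (wco ψ φ h (repro p))
      = ((‖ψ p‖ ^ 2 * ‖repro p‖ ^ 2 : ℝ) : ℂ) := by
    have h3 : inner ℂ (repro p) (repro p) = ((‖repro p‖ : ℝ) : ℂ) ^ 2 :=
      inner_self_eq_norm_sq_to_K _
    rw [inner_smul_left, inner_repro, wco_apply, hp, ← inner_repro, h3, ← mul_assoc,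
      Complex.conj_mul']
    push_cast
    rfl
  rw [norm_sub_rev, @norm_sub_sq ℂ, h2, norm_smul]
  have h4 := pow_le_pow_left₀ (norm_nonneg _) h1 2
  simp only [RCLike.re_to_complex, Complex.ofReal_re]
  nlinarith

theorem norm_wco_le_of_isNormaloid {ψ : ℂ → ℂ} (hψ : Differentiable ℂ ψ) {a b p : ℂ}
    (ha : ‖a‖ ≤ 1) (hp : a * p + b = p) (h : IsBoundedWCO ψ (fun z => a * z + b))
    (hess : ∀ l ∈ essentialSpectrum (wco ψ _ h), ‖l‖ ≤ ‖ψ p‖)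
    (hn : IsNormaloid (wco ψ _ h)) : ‖wco ψ _ h‖ ≤ ‖ψ p‖ := by
  obtain ⟨l, hl, hl'⟩ := spectrum.exists_nnnorm_eq_spectralRadius (wco ψ _ h)
  rw [hn, ENNReal.coe_inj] at hl'
  have hnorm : ‖l‖ = ‖wco ψ _ h‖ := congrArg NNReal.toReal hl'
  rw [← hnorm]
  by_contra hlt
  have hl0 : l ≠ 0 := by
    rintro rfl
    exact hlt (by simp)
  obtain ⟨f, hf0, hf⟩ :=
    exists_eigenvector_of_norm_eq _ hl hl0 hnorm fun hmem => hlt (hess l hmem)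
  refine hlt (norm_eigenvalue_le hψ f.differentiable (fun h0 => hf0 ?_) ha hp fun z => ?_)
  · exact FockSpace.ext fun z => congrFun h0 z
  · rw [← wco_apply h, hf, FockSpace.smul_apply]

end Fock

end

/-! ### The characterization -/

theorem theorem2p4 (ψ : ℂ → ℂ) (hψ : Differentiable ℂ ψ) (hψ0 : ψ ≠ 0)
    (a b : ℂ) (ha : ‖a‖ < 1)
    (hess : ∀ h : Fock.IsBoundedWCO ψ (fun z => a * z + b),
      ∀ l ∈ Fock.essentialSpectrum (Fock.wco ψ (fun z => a * z + b) h), ‖l‖ ≤ ‖ψ (b / (1 - a))‖) :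
    (∃ h : Fock.IsBoundedWCO ψ (fun z => a * z + b),
      Fock.IsNormaloid (Fock.wco ψ (fun z => a * z + b) h)) ↔
    ψ = fun z => ψ 0 * Fock.kernel (b * (((starRingEnd ℂ) a - 1) / (a - 1))) z := by
  have ha1 : 1 - a ≠ 0 := by
    intro h
    rw [← sub_eq_zero.1 h, norm_one] at ha
    exact lt_irrefl _ ha
  have ha2 : 1 - (starRingEnd ℂ) a ≠ 0 := by
    intro h
    apply ha1
    simpa using congrArg (starRingEnd ℂ) h
  have ha1' : a - 1 ≠ 0 := fun h => ha1 (by linear_combination -h)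
  have ha2' : (starRingEnd ℂ) a - 1 ≠ 0 := fun h => ha2 (by linear_combination -h)
  constructor
  · rintro ⟨h, hn⟩
    set p := b / (1 - a) with hp
    have hpfix : a * p + b = p := by
      rw [hp]
      field_simp
      ring
    have heig := Fock.wco_repro_eq_of_norm_le h hpfix
      (Fock.norm_wco_le_of_isNormaloid hψ ha.le hpfix h (hess h) hn)
    have hval (z : ℂ) : ψ z * Fock.kernel p (a * z + b) = ψ p * Fock.kernel p z := by
      have := congrArg (fun f : Fock.FockSpace => f z) heig
      exact this
    -- The exponents differ by `conj p * (1 - a) * z - conj p * b`, and `conj p * (1 - a)` is the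
    -- conjugate of the claimed kernel parameter.
    have hker (z : ℂ) : Fock.kernel p z = Fock.kernel p (a * z + b)
        * (Complex.exp (-((starRingEnd ℂ) p * b))
          * Fock.kernel (b * (((starRingEnd ℂ) a - 1) / (a - 1))) z) := by
      simp only [Fock.kernel, ← Complex.exp_add, hp, map_mul, map_div₀, map_sub, map_one,
        Complex.conj_conj]
      congr 1
      field_simp
      ring
    have hsol (z : ℂ) : ψ z = ψ p * Complex.exp (-((starRingEnd ℂ) p * b))
        * Fock.kernel (b * (((starRingEnd ℂ) a - 1) / (a - 1))) z := by
      have hne : Fock.kernel p (a * z + b) ≠ 0 := Complex.exp_ne_zero _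
      refine mul_right_cancel₀ hne ?_
      rw [hval z, hker z]
      ring
    have h0 : ψ 0 = ψ p * Complex.exp (-((starRingEnd ℂ) p * b)) := by
      rw [hsol 0]
      simp [Fock.kernel]
    funext z
    rw [hsol z, h0]
  · intro hform
    set c := b * (((starRingEnd ℂ) a - 1) / (a - 1)) with hc
    rw [hform]
    have h := Fock.isBoundedWCO_of_kernel ha (ψ 0) b c
    refine ⟨h, ?_⟩
    -- The factor `(conj a - 1) / (a - 1)` is unimodular, whence `‖c‖ = ‖b‖`.
    have hnormal := Fock.isStarNormal_wco_kernel h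
      (by rw [hc]; field_simp; ring)
      (by
        rw [hc]
        simp only [map_mul, map_div₀, map_sub, map_one, Complex.conj_conj]
        field_simp)
    exact IsStarNormal.spectralRadius_eq_nnnorm _
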